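/- For integers $n\ge 1$ and $0\le k<n$ put \[ U_{n,k}=\prod_{\ell=1}^{n-k}(\ell!)^{n/\ell},\qquad E_{n,k}=\frac{U_{n,k}\,[n!/e]^{\,n-k-1}}{L_n/n!}, \] where $[x]$ is the integer nearest to $x$ and $L_n$ is the number of Latin squares of order $n$ ($n\times n$ arrays with entries in $\{1,\dots,n\}$ in which every symbol occurs exactly once in each row and in each column). Let $k=k(n)$ be a sequence of nonnegative integers. As $n\to\infty$, where $f\sim g$ means $f=(1+o(1))g$: 1. If $k=o(n)$, then $\log E_{n,k}\sim n^2\log n$. 2. If $0<t<1$ and $k\sim(1-t)n$, then $\log E_{n,k}\sim(2t-1)\,n^2\log n$ when $t\ne\tfrac12$, and $\log E_{n,k}=o(n^2\log n)$ when $t=\tfrac12$. 3. If $0<r<1$, $0<\alpha<1$ and $n-k\sim r\,n^{\alpha}$ (in particular if $k$ is $n-r\,n^{\alpha}$ rounded to an integer), then $\log E_{n,k}\sim r(1+\alpha)\,n^{1+\alpha}\log n-n^2\log n$. (In each case $k<n$ for all large $n$.) -/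

import Mathlib

open Filter Topology Asymptotics
open scoped Nat

/-- A Latin square of order `n`: an `n × n` array with entries in an `n`-element alphabet in which
every symbol occurs exactly once in each row and exactly once in each column. -/
def IsLatinSquare {n : ℕ} (A : Fin n → Fin n → Fin n) : Prop :=
  (∀ i, Function.Bijective fun j => A i j) ∧ (∀ j, Function.Bijective fun i => A i j)

/-- The number `L_n = |LS_n|` of Latin squares of order `n`. -/
noncomputable def latinCount (n : ℕ) : ℕ :=
  Nat.card {A : Fin n → Fin n → Fin n // IsLatinSquare A}

/-- `U_{n,k} = ∏_{ℓ=1}^{n-k} (ℓ!)^{n/ℓ}`, the upper bound for the number of completions of a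
`k × n` Latin rectangle to a Latin square (used for `k < n`). -/
noncomputable def completionBound (n k : ℕ) : ℝ :=
  ∏ l ∈ Finset.Icc 1 (n - k), ((l ! : ℕ) : ℝ) ^ ((n : ℝ) / (l : ℝ))

/-- `E_{n,k} = U_{n,k} [n!/e]^{n-k-1} / (L_n / n!)`, where `[x]` is the integer nearest to `x`
(used for `k < n`). -/
noncomputable def rejectionCost (n k : ℕ) : ℝ :=
  completionBound n k * (round (((n ! : ℕ) : ℝ) / Real.exp 1) : ℝ) ^ (n - k - 1) /
    ((latinCount n : ℝ) / ((n ! : ℕ) : ℝ))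

/-! All three cases follow from one estimate, uniform in `k < n`: $\log E_{n,k} = (2(n-k)-n)\,n\log
n + O(n^2)$. By crude Stirling bounds, $U_{n,k}$ and the power of the rounded factorial each
contribute $n(n-k)\log n$, and $L_n$ contributes $-n^2\log n$; all other terms are $O(n^2)$.
Dividing by $n^2\log n$ gives the limit $2\tau-1$ with $\tau=\lim (n-k)/n$, equal to $1$, $t$ and
$0$ in the three cases.

The hard input is the lower bound $L_n\ge (n!/e^n)^n$. Building the square row by row, the
compatible next rows are perfect matchings of an $(n-k)$-regular bipartite graph, so it suffices
that a doubly stochastic matrix has permanent at least $e^{-n}$. This follows Gurvits' method: the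
permanent is a full mixed derivative of $\prod z_i$ along the rows. Zero-free regions make the
one-variable restrictions real-rooted, and each differentiation then costs at most a factor $e$ in a
lower bound that starts from AM-GM. -/

section PolarProd

/-! ### Mixed derivatives of a monomial: zero-free regions and the loss of a factor $e$. -/

variable {ι : Type*} [DecidableEq ι]

/-- The mixed directional derivative, along the vectors of the list `ws`, of the monomial
`z ↦ ∏ i ∈ S, z i`. -/
def polarProd {R : Type*} [CommRing R] : List (ι → R) → Finset ι → (ι → R) → R
  | [], S, z => ∏ i ∈ S, z i
  | w :: ws, S, z => ∑ i ∈ S, w i * polarProd ws (S.erase i) z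

theorem map_polarProd {R R' : Type*} [CommRing R] [CommRing R'] (F : R →+* R')
    (ws : List (ι → R)) (S : Finset ι) (z : ι → R) :
    F (polarProd ws S z) = polarProd (ws.map fun w i => F (w i)) S (fun i => F (z i)) := by
  induction ws generalizing S with
  | nil => simp [polarProd]
  | cons w ws ih => simp [polarProd, ih]

/-- Both sides sum over ordered pairs of distinct indices of `S`; this is the symmetry of mixed
derivatives. -/
theorem polarProd_swap {R : Type*} [CommRing R] (v w : ι → R) (ws : List (ι → R))
    (S : Finset ι) (z : ι → R) :
    polarProd (v :: w :: ws) S z = polarProd (w :: v :: ws) S z := by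
  simp only [polarProd, Finset.mul_sum]
  rw [Finset.sum_comm' (t' := S) (s' := fun j => S.erase j)
    (fun x y => by simp only [Finset.mem_erase]; tauto)]
  refine Finset.sum_congr rfl fun i _ => Finset.sum_congr rfl fun j _ => ?_
  rw [Finset.erase_right_comm]
  ring

theorem polarProd_smul {R : Type*} [CommRing R] (c : R) (ws : List (ι → R)) (S : Finset ι)
    (z : ι → R) (h : ws.length ≤ S.card) :
    polarProd ws S (fun i => c * z i) = c ^ (S.card - ws.length) * polarProd ws S z := by
  induction ws generalizing S with
  | nil => simp [polarProd, Finset.prod_mul_distrib]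
  | cons w ws ih =>
    simp only [polarProd, Finset.mul_sum]
    refine Finset.sum_congr rfl fun i hi => ?_
    have hc := Finset.card_erase_add_one hi
    simp only [List.length_cons] at h ⊢
    rw [ih _ (by omega), show (S.erase i).card - ws.length = S.card - (ws.length + 1) by omega]
    ring

open Polynomial in
-- The chain rule along a line of direction `w`. Differentiation reaches the innermost monomial
-- first, and `polarProd_swap` brings the new direction to the head.
theorem derivative_polarProd {R : Type*} [CommRing R] (ws : List (ι → R)) (w : ι → R)
    (S : Finset ι) (z : ι → R[X]) (hz : ∀ i, derivative (z i) = C (w i)) :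
    derivative (polarProd (ws.map fun v i => C (v i)) S z) =
      polarProd ((w :: ws).map fun v i => C (v i)) S z := by
  induction ws generalizing S with
  | nil =>
    simp only [List.map_nil, List.map_cons, polarProd, derivative_prod_finset, hz]
    exact Finset.sum_congr rfl fun i _ => mul_comm _ _
  | cons v ws ih =>
    rw [List.map_cons, List.map_cons, List.map_cons, polarProd_swap]
    simp only [polarProd, derivative_sum, derivative_C_mul, ih]
    simp [polarProd]

/-- The restriction of a mixed directional derivative to the complex line through `z` in
direction `w`. -/
noncomputable def polarLine (ws : List (ι → ℝ)) (S : Finset ι) (z : ι → ℂ) (w : ι → ℝ) :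
    Polynomial ℂ :=
  polarProd (ws.map fun v i => Polynomial.C (v i : ℂ)) S
    (fun i => Polynomial.C (z i) + Polynomial.C (w i : ℂ) * Polynomial.X)

/-- The mixed directional derivative along real vectors, at a complex point. -/
noncomputable def polarC (ws : List (ι → ℝ)) (S : Finset ι) (z : ι → ℂ) : ℂ :=
  polarProd (ws.map fun v i => (v i : ℂ)) S z

theorem eval_polarLine (ws : List (ι → ℝ)) (S : Finset ι) (z : ι → ℂ) (w : ι → ℝ) (s : ℂ) :
    (polarLine ws S z w).eval s = polarC ws S (fun i => z i + w i * s) := by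
  have := map_polarProd (Polynomial.evalRingHom s)
    (ws.map fun v i => Polynomial.C (v i : ℂ)) S
    (fun i => Polynomial.C (z i) + Polynomial.C (w i : ℂ) * Polynomial.X)
  simpa [polarLine, polarC, List.map_map, Function.comp_def] using this

theorem eval_derivative_polarLine (ws : List (ι → ℝ)) (S : Finset ι) (z : ι → ℂ) (w : ι → ℝ)
    (s : ℂ) :
    (polarLine ws S z w).derivative.eval s = polarC (w :: ws) S (fun i => z i + w i * s) := by
  rw [← eval_polarLine, polarLine, polarLine]
  have := derivative_polarProd (ws.map fun v i => (v i : ℂ)) (fun i => (w i : ℂ)) S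
    (fun i => Polynomial.C (z i) + Polynomial.C (w i : ℂ) * Polynomial.X) (by simp)
  simp only [List.map_map, List.map_cons, Function.comp_def] at this ⊢
  rw [this]

theorem polarC_ofReal (ws : List (ι → ℝ)) (S : Finset ι) (z : ι → ℝ) :
    polarC ws S (fun i => (z i : ℂ)) = (polarProd ws S z : ℝ) :=
  (map_polarProd Complex.ofRealHom ws S z).symm

theorem polarC_smul (c : ℂ) (ws : List (ι → ℝ)) (S : Finset ι)
    (z : ι → ℂ) (h : ws.length ≤ S.card) :
    polarC ws S (fun i => c * z i) = c ^ (S.card - ws.length) * polarC ws S z := by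
  simpa [polarC] using polarProd_smul c (ws.map fun v i => (v i : ℂ)) S z (by simpa using h)

/-- Mixed derivatives of a monomial along positive vectors have no zeros with all coordinates in
the open right half-plane. -/
theorem polarC_ne_zero (ws : List (ι → ℝ)) (hws : ∀ w ∈ ws, ∀ i, 0 < w i) (S : Finset ι)
    (h : ws.length ≤ S.card) (z : ι → ℂ) (hz : ∀ i, 0 < (z i).re) : polarC ws S z ≠ 0 := by
  induction ws generalizing z with
  | nil =>
    refine Finset.prod_ne_zero_iff.2 fun i _ h0 => ?_
    simpa [h0] using hz i
  | cons w ws ih =>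
    simp only [List.length_cons] at h
    have hw := hws w (by simp)
    replace ih := ih (fun v hv => hws v (by simp [hv])) (by omega)
    set f := polarLine ws S z w with hf
    -- Moving from `z` by `w * s` with `0 ≤ s.re` stays in the right half-plane, where the induction
    -- hypothesis forbids zeros.
    have hroot : ∀ s : ℂ, f.eval s = 0 → s.re < 0 := by
      intro s hs
      by_contra! hre
      rw [hf, eval_polarLine] at hs
      refine ih _ (fun i => ?_) hs
      have : 0 ≤ w i * s.re := mul_nonneg (hw i).le hre
      simpa using add_pos_of_pos_of_nonneg (hz i) this
    have hf' : f.derivative.eval 0 = polarC (w :: ws) S z := by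
      simp [hf, eval_derivative_polarLine]
    have hdeg : 0 < f.degree := by
      by_contra! hd
      have hC := Polynomial.eq_C_of_degree_le_zero hd
      set a := f.coeff 0
      -- The reversed line `u ↦ u z + w` would be the polynomial `a u ^ m` with `m > 0`.
      set g : Polynomial ℂ := polarProd (ws.map fun v i => Polynomial.C (v i : ℂ)) S
        (fun i => Polynomial.C (w i : ℂ) + Polynomial.C (z i) * Polynomial.X)
      have hg : ∀ u, g.eval u = polarC ws S (fun i => w i + z i * u) := by
        intro u
        have := map_polarProd (Polynomial.evalRingHom u)
          (ws.map fun v i => Polynomial.C (v i : ℂ)) S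
          (fun i => Polynomial.C (w i : ℂ) + Polynomial.C (z i) * Polynomial.X)
        simpa [g, polarC, List.map_map, Function.comp_def] using this
      have hgX : g = Polynomial.C a * Polynomial.X ^ (S.card - ws.length) := by
        refine Polynomial.eq_of_infinite_eval_eq _ _ ?_
        refine Set.Infinite.mono (s := {0}ᶜ) (fun u hu => ?_)
          (Set.finite_singleton _).infinite_compl
        have hu0 : u ≠ 0 := hu
        have h1 : f.eval u⁻¹ = a := by rw [hC, Polynomial.eval_C]
        rw [hf, eval_polarLine] at h1
        rw [Set.mem_ofPred_eq, hg, Polynomial.eval_mul, Polynomial.eval_C, Polynomial.eval_pow,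
          Polynomial.eval_X, ← h1, mul_comm, ← polarC_smul _ _ _ _ (by omega)]
        congr 1
        funext i
        field_simp
        ring
      have h0 : g.eval 0 = 0 := by
        rw [hgX]
        simp [show S.card - ws.length ≠ 0 by omega]
      rw [hg] at h0
      exact ih _ (fun i => by simpa using hw i) h0
    rw [← hf']
    intro h0
    have hmem : (0 : ℂ) ∈ f.derivative.rootSet ℂ := by
      have hd : f.derivative ≠ 0 := by
        intro hd
        have := Polynomial.derivative_eq_zero.1 hd
        rw [← Polynomial.natDegree_pos_iff_degree_pos] at hdeg
        omega
      rw [Polynomial.mem_rootSet]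
      exact ⟨hd, by simpa using h0⟩
    -- Gauss–Lucas: critical points lie in the convex hull of the roots, so `0` cannot be one.
    have hsub : convexHull ℝ (f.rootSet ℂ) ⊆ {s : ℂ | s.re < 0} := by
      refine convexHull_min (fun s hs => ?_) (convex_halfSpace_re_lt 0)
      rw [Polynomial.mem_rootSet, Polynomial.coe_aeval_eq_eval] at hs
      exact hroot s hs.2
    simpa using hsub (Polynomial.rootSet_derivative_subset_convexHull_rootSet hdeg hmem)

/-- If `s` is not a nonpositive real, then `c = ‖s‖ + conj s` makes both `c` and `c * s` have
positive real part. By homogeneity, multiplying the point by `c` would give a zero in the right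
half-plane, against `polarC_ne_zero`. -/
theorem eval_polarLine_eq_zero (ws : List (ι → ℝ)) (hws : ∀ w ∈ ws, ∀ i, 0 < w i) (S : Finset ι)
    (h : ws.length ≤ S.card) (y w : ι → ℝ) (hy : ∀ i, 0 ≤ y i) (hw : ∀ i, 0 < w i) (s : ℂ)
    (hs : (polarLine ws S (fun i => (y i : ℂ)) w).eval s = 0) : s.im = 0 ∧ s.re ≤ 0 := by
  by_contra hcon
  have hpos : 0 < ‖s‖ + s.re := by
    by_contra! hle
    have h1 := Complex.abs_re_le_norm s
    have h2 : |s.re| = ‖s‖ := le_antisymm h1 (by linarith [neg_abs_le s.re])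
    have h3 := Complex.abs_re_eq_norm.1 h2
    exact hcon ⟨h3, by linarith [norm_nonneg s]⟩
  have hs0 : 0 < ‖s‖ := by
    rw [norm_pos_iff]
    rintro rfl
    simp at hpos
  set c : ℂ := (‖s‖ : ℂ) + (starRingEnd ℂ) s with hc
  have hcs : c * s = (‖s‖ : ℂ) * (s + ‖s‖) := by
    rw [hc, add_mul, Complex.conj_mul']
    ring
  rw [eval_polarLine] at hs
  have hne : polarC ws S (fun i => c * (y i + w i * s)) ≠ 0 := by
    refine polarC_ne_zero ws hws S h _ fun i => ?_
    have : c * (y i + w i * s) = y i * c + w i * (c * s) := by ring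
    rw [this, hcs]
    have hre : (y i * c + w i * ((‖s‖ : ℂ) * (s + ‖s‖)) : ℂ).re
        = y i * (‖s‖ + s.re) + w i * (‖s‖ * (s.re + ‖s‖)) := by
      simp [hc]
    rw [hre]
    have h1 := mul_nonneg (hy i) hpos.le
    have h2 := mul_pos (hw i) (mul_pos hs0 hpos)
    linarith
  exact hne (by rw [polarC_smul _ _ _ _ h, hs, mul_zero])

/-- Root by root, with `z = -r`: $t+r\le r\,e^{t/r}$. -/
theorem norm_prod_sub_le_of_real_nonpos (M : Multiset ℂ)
    (hM : ∀ z ∈ M, z.im = 0 ∧ z.re < 0) (t : ℝ) (ht : 0 < t) :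
    ‖(M.map fun z => (t : ℂ) - z).prod‖ ≤
      ‖(M.map fun z => 0 - z).prod‖ * Real.exp (t * (M.map fun z => 1 / (0 - z)).sum.re) := by
  induction M using Multiset.induction_on with
  | empty => simp
  | cons a M ih =>
    obtain ⟨him, hre⟩ := hM a (by simp)
    replace ih := ih fun z hz => hM z (by simp [hz])
    obtain ⟨r, rfl⟩ : ∃ r : ℝ, a = ((-r : ℝ) : ℂ) := ⟨-a.re, by apply Complex.ext <;> simp [him]⟩
    have hr : 0 < r := by simpa using hre
    simp only [Multiset.map_cons, Multiset.prod_cons, Multiset.sum_cons, norm_mul, Complex.add_re,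
      mul_add, Real.exp_add]
    have h1 : ‖(t : ℂ) - ((-r : ℝ) : ℂ)‖ = t + r := by
      rw [← Complex.ofReal_sub, Complex.norm_of_nonneg (by linarith)]; ring
    have h2 : ‖(0 : ℂ) - ((-r : ℝ) : ℂ)‖ = r := by
      rw [← Complex.ofReal_zero, ← Complex.ofReal_sub, Complex.norm_of_nonneg (by linarith)]; ring
    have h3 : (1 / ((0 : ℂ) - ((-r : ℝ) : ℂ))).re = 1 / r := by
      rw [← Complex.ofReal_zero, ← Complex.ofReal_sub, ← Complex.ofReal_one, ← Complex.ofReal_div,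
        Complex.ofReal_re]
      simp
    rw [h1, h2, h3]
    have h4 : t + r ≤ r * Real.exp (t * (1 / r)) := by
      have := Real.add_one_le_exp (t * (1 / r))
      calc t + r = r * (t * (1 / r) + 1) := by field_simp
        _ ≤ _ := by gcongr
    calc _ ≤ (r * Real.exp (t * (1 / r))) * (_ * _) :=
          mul_le_mul h4 ih (norm_nonneg _) (by positivity)
      _ = _ := by ring

/-- A polynomial with only nonpositive real roots that dominates `K t` for `t > 0` has derivative
at least `K / e` at the origin. -/
theorem div_exp_le_norm_derivative (f : Polynomial ℂ)
    (hf : ∀ s, f.eval s = 0 → s.im = 0 ∧ s.re ≤ 0) (K : ℝ) (hK : 0 < K)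
    (hfK : ∀ t : ℝ, 0 < t → K * t ≤ ‖f.eval (t : ℂ)‖) :
    K / Real.exp 1 ≤ ‖f.derivative.eval 0‖ := by
  -- If `f` vanishes at `0`, divide by `X` and let `t` tend to `0`; this even gives the bound `K`.
  by_cases h0 : f.eval 0 = 0
  · obtain ⟨g, rfl⟩ : Polynomial.X ∣ f := by
      rw [Polynomial.X_dvd_iff, Polynomial.coeff_zero_eq_eval_zero, h0]
    have hg : ∀ t : ℝ, 0 < t → K ≤ ‖g.eval (t : ℂ)‖ := by
      intro t ht
      have := hfK t ht
      rw [Polynomial.eval_mul, Polynomial.eval_X, norm_mul, Complex.norm_of_nonneg ht.le,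
        mul_comm] at this
      exact le_of_mul_le_mul_left this ht
    have hlim : Tendsto (fun t : ℝ => ‖g.eval (t : ℂ)‖) (𝓝[>] 0) (𝓝 ‖g.eval ((0 : ℝ) : ℂ)‖) := by
      have : Continuous fun t : ℝ => ‖g.eval (t : ℂ)‖ := by fun_prop
      exact (this.tendsto 0).mono_left nhdsWithin_le_nhds
    have hle : K ≤ ‖g.eval ((0 : ℝ) : ℂ)‖ :=
      ge_of_tendsto hlim (eventually_nhdsWithin_of_forall fun t ht => hg t ht)
    have : (Polynomial.X * g).derivative.eval 0 = g.eval ((0 : ℝ) : ℂ) := by simp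
    rw [this]
    exact (div_le_self hK.le (Real.one_le_exp zero_le_one)).trans hle
  · have hsp := IsAlgClosed.splits f
    have hfne : f ≠ 0 := by rintro rfl; simp at h0
    set b := ‖f.eval 0‖
    have hb : 0 < b := norm_pos_iff.2 h0
    set S := ‖f.derivative.eval 0‖ / b with hS
    have hroots : ∀ z ∈ f.roots, z.im = 0 ∧ z.re < 0 := by
      intro z hz
      have hz0 : f.eval z = 0 := (Polynomial.mem_roots hfne).1 hz
      obtain ⟨h1, h2⟩ := hf z hz0
      refine ⟨h1, lt_of_le_of_ne h2 fun h3 => h0 ?_⟩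
      rwa [show z = 0 from Complex.ext h3 h1] at hz0
    -- The sum of `1 / (0 - z)` over the roots is the logarithmic derivative at `0`, whose modulus
    -- is `S`.
    have hbound : ∀ t : ℝ, 0 < t → K * t ≤ b * Real.exp (t * S) := by
      intro t ht
      refine (hfK t ht).trans ?_
      have h1 := norm_prod_sub_le_of_real_nonpos f.roots hroots t ht
      rw [← hsp.eval_derivative_div_eval_of_ne_zero h0] at h1
      have h2 : (f.derivative.eval 0 / f.eval 0).re ≤ S := by
        rw [hS, ← norm_div]; exact Complex.re_le_norm _
      have h3 : b = ‖f.leadingCoeff‖ * ‖(f.roots.map fun z => 0 - z).prod‖ := by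
        rw [← norm_mul, ← hsp.eval_eq_prod_roots]
      rw [hsp.eval_eq_prod_roots, norm_mul, h3, mul_assoc]
      refine mul_le_mul_of_nonneg_left (h1.trans ?_) (norm_nonneg _)
      gcongr
    have hSpos : 0 < S := by
      refine lt_of_le_of_ne (by positivity) fun hS0 => ?_
      have := hbound ((b + 1) / K) (by positivity)
      rw [← hS0, mul_zero, Real.exp_zero, mul_one, mul_div_cancel₀ _ hK.ne'] at this
      linarith
    -- This `t` minimises $b\,e^{tS}/t$, and the minimum is $e\,b\,S = e\,|f'(0)|$.
    have := hbound (1 / S) (by positivity)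
    rw [one_div, inv_mul_cancel₀ hSpos.ne', ← div_eq_mul_inv, div_le_iff₀ hSpos] at this
    rw [div_le_iff₀ (Real.exp_pos 1)]
    calc K ≤ b * Real.exp 1 * S := this
      _ = _ := by rw [hS]; field_simp

/-- Differentiating a mixed derivative once more in direction `w` costs at most a factor `e` in the
capacity lower bound. -/
theorem div_exp_le_polarProd_cons (ws : List (ι → ℝ)) (hws : ∀ w ∈ ws, ∀ i, 0 < w i)
    (S : Finset ι) (h : ws.length ≤ S.card) (y w : ι → ℝ) (hy : ∀ i, 0 ≤ y i)
    (hw : ∀ i, 0 < w i) (K : ℝ) (hK : 0 < K)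
    (hfK : ∀ t : ℝ, 0 < t → K * t ≤ polarProd ws S (fun i => y i + w i * t))
    (hnonneg : 0 ≤ polarProd (w :: ws) S y) :
    K / Real.exp 1 ≤ polarProd (w :: ws) S y := by
  have := div_exp_le_norm_derivative (polarLine ws S (fun i => (y i : ℂ)) w)
    (eval_polarLine_eq_zero ws hws S h y w hy hw) K hK (fun t ht => by
      rw [eval_polarLine]
      have h1 := polarC_ofReal ws S (fun i => y i + w i * t)
      push_cast at h1
      rw [h1]
      exact (hfK t ht).trans ((le_abs_self _).trans (Complex.norm_real _).ge))
  rw [eval_derivative_polarLine] at this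
  simp only [mul_zero, add_zero, polarC_ofReal, Complex.norm_real] at this
  rwa [Real.norm_of_nonneg hnonneg] at this

theorem polarProd_nonneg (ws : List (ι → ℝ)) (hws : ∀ w ∈ ws, ∀ i, 0 ≤ w i) (S : Finset ι)
    (z : ι → ℝ) (hz : ∀ i, 0 ≤ z i) : 0 ≤ polarProd ws S z := by
  induction ws generalizing S with
  | nil => exact Finset.prod_nonneg fun i _ => hz i
  | cons w ws ih =>
    exact Finset.sum_nonneg fun i hi => mul_nonneg (hws w (by simp) i)
      (ih (fun v hv => hws v (by simp [hv])) _)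

end PolarProd

/-! ### Permanents of doubly stochastic matrices and perfect matchings. -/

section Permanent

/-- Row sums split each `x j` into powers `x j ^ a j i`; column sums make these exponents weights
for AM-GM. -/
theorem prod_le_prod_sum_of_doublyStochastic {ι : Type*} [Fintype ι] (a : ι → ι → ℝ)
    (ha : ∀ j i, 0 ≤ a j i) (hrow : ∀ j, ∑ i, a j i = 1) (hcol : ∀ i, ∑ j, a j i = 1)
    (x : ι → ℝ) (hx : ∀ j, 0 < x j) : ∏ j, x j ≤ ∏ i, ∑ j, x j * a j i := by
  calc ∏ j, x j = ∏ j, ∏ i, x j ^ a j i := by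
        refine Finset.prod_congr rfl fun j _ => ?_
        rw [← Real.rpow_sum_of_pos (hx j), hrow, Real.rpow_one]
    _ = ∏ i, ∏ j, x j ^ a j i := Finset.prod_comm
    _ ≤ ∏ i, ∑ j, x j * a j i := by
        refine Finset.prod_le_prod (fun i _ => Finset.prod_nonneg fun j _ =>
          Real.rpow_nonneg (hx j).le _) fun i _ => ?_
        refine (Real.geom_mean_le_arith_mean_weighted Finset.univ (fun j => a j i) x
          (fun j _ => ha j i) (hcol i) fun j _ => (hx j).le).trans_eq ?_
        exact Finset.sum_congr rfl fun j _ => mul_comm _ _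

/-- Gurvits' induction: rows in `L` have been differentiated away, the others still carry variables.
Each new row turns its variable into the parameter `t` of `div_exp_le_polarProd_cons`. -/
theorem exp_mul_prod_le_polarProd {ι : Type*} [Fintype ι] [DecidableEq ι] (a : ι → ι → ℝ)
    (ha : ∀ j i, 0 < a j i) (hrow : ∀ j, ∑ i, a j i = 1) (hcol : ∀ i, ∑ j, a j i = 1)
    (L : List ι) (hL : L.Nodup) (x : ι → ℝ) (hx : ∀ j, 0 < x j) :
    (∏ j ∈ L.toFinsetᶜ, x j) / Real.exp 1 ^ L.length ≤
      polarProd (L.map a) Finset.univ (fun i => ∑ j ∈ L.toFinsetᶜ, x j * a j i) := by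
  induction L generalizing x with
  | nil =>
    simpa [polarProd] using
      prod_le_prod_sum_of_doublyStochastic a (fun j i => (ha j i).le) hrow hcol x hx
  | cons j L ih =>
    obtain ⟨hj, hL⟩ := List.nodup_cons.1 hL
    have hjT : j ∈ L.toFinsetᶜ := by simpa using hj
    have hT : (j :: L).toFinsetᶜ = L.toFinsetᶜ.erase j := by
      ext b; simp
    have hlen : L.length ≤ (Finset.univ : Finset ι).card := by
      rw [← List.toFinset_card_of_nodup hL]; exact Finset.card_le_univ _
    rw [hT, List.length_cons, pow_succ, ← div_div, List.map_cons]
    have hy : ∀ i, 0 ≤ ∑ b ∈ L.toFinsetᶜ.erase j, x b * a b i := fun i =>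
      Finset.sum_nonneg fun b _ => (mul_pos (hx b) (ha b i)).le
    refine div_exp_le_polarProd_cons (L.map a) ?_ Finset.univ (by simpa using hlen) _ (a j) hy
      (ha j) _ (div_pos (Finset.prod_pos fun b _ => hx b) (by positivity)) (fun t ht => ?_) ?_
    · intro w hw i
      obtain ⟨b, -, rfl⟩ := List.mem_map.1 hw
      exact ha b i
    · have h1 := ih hL (Function.update x j t) fun b => by
        by_cases hb : b = j
        · subst hb; simpa using ht
        · simpa [hb] using hx b
      rw [← Finset.mul_prod_erase _ _ hjT] at h1
      simp only [← Finset.add_sum_erase _ _ hjT, Function.update_self] at h1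
      have h2 : ∏ b ∈ L.toFinsetᶜ.erase j, Function.update x j t b
          = ∏ b ∈ L.toFinsetᶜ.erase j, x b :=
        Finset.prod_congr rfl fun b hb => Function.update_of_ne (Finset.ne_of_mem_erase hb) _ _
      have h3 : ∀ i, ∑ b ∈ L.toFinsetᶜ.erase j, Function.update x j t b * a b i
          = ∑ b ∈ L.toFinsetᶜ.erase j, x b * a b i := fun i =>
        Finset.sum_congr rfl fun b hb => by
          rw [Function.update_of_ne (Finset.ne_of_mem_erase hb)]
      rw [h2] at h1
      simp only [h3] at h1
      convert h1 using 1
      · ring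
      · congr 1
        funext i
        ring
    · refine polarProd_nonneg _ (fun w hw i => ?_) _ _ hy
      rcases List.mem_cons.1 hw with rfl | hw
      · exact (ha j i).le
      · obtain ⟨b, -, rfl⟩ := List.mem_map.1 hw
        exact (ha b i).le

open Classical in
-- Each derivative removes the index it uses, so only injective choices survive; for `n` rows in `n`
-- variables this is the permanent.
theorem polarProd_ofFn_one {ι R : Type*} [Fintype ι] [DecidableEq ι] [CommRing R] {k : ℕ}
    (w : Fin k → ι → R) (S : Finset ι) :
    polarProd (List.ofFn w) S (fun _ => 1) =
      ∑ g : Fin k → ι, if Function.Injective g ∧ ∀ j, g j ∈ S then ∏ j, w j (g j) else 0 := by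
  induction k generalizing S with
  | zero => simp [polarProd, Function.injective_of_subsingleton]
  | succ k ih =>
    rw [List.ofFn_succ, polarProd, ← (Fin.consEquiv fun _ => ι).sum_comp, Fintype.sum_prod_type,
      ← Finset.sum_subset (Finset.subset_univ S)]
    · refine Finset.sum_congr rfl fun i hi => ?_
      rw [ih, Finset.mul_sum]
      refine Finset.sum_congr rfl fun g _ => ?_
      rw [mul_ite, mul_zero]
      refine if_congr ?_ ?_ rfl
      · simp only [Fin.consEquiv, Equiv.coe_fn_mk, Fin.cons_injective_iff, Fin.forall_fin_succ,
          Fin.cons_zero, Fin.cons_succ, Finset.mem_erase, Set.mem_range, not_exists]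
        constructor
        · rintro ⟨h1, h2⟩
          exact ⟨⟨fun j => (h2 j).1, h1⟩, hi, fun j => (h2 j).2⟩
        · rintro ⟨⟨h1, h2⟩, -, h3⟩
          exact ⟨h2, fun j => ⟨h1 j, h3 j⟩⟩
      · simp [Fin.consEquiv, Fin.prod_univ_succ]
    · intro i _ hi
      refine Finset.sum_eq_zero fun g _ => if_neg fun h => hi ?_
      simpa [Fin.consEquiv] using h.2 0

open Classical in
/-- The permanent of an `n × n` doubly stochastic matrix with positive entries is at least
`e ^ (-n)`. -/
theorem one_div_exp_le_permanent_of_pos {n : ℕ} (a : Fin n → Fin n → ℝ)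
    (ha : ∀ j i, 0 < a j i) (hrow : ∀ j, ∑ i, a j i = 1) (hcol : ∀ i, ∑ j, a j i = 1) :
    1 / Real.exp 1 ^ n ≤
      ∑ g : Fin n → Fin n, if Function.Injective g then ∏ j, a j (g j) else 0 := by
  have h1 := exp_mul_prod_le_polarProd a ha hrow hcol (List.finRange n) (List.nodup_finRange n)
    (fun _ => 1) fun _ => one_pos
  have h2 := polarProd_ofFn_one a Finset.univ
  -- The full derivative has degree `0`, so its value at the origin equals its value at the all-ones
  -- point.
  have h3 := polarProd_smul (0 : ℝ) (List.ofFn a) Finset.univ (fun _ => 1) (by simp)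
  simp only [List.length_ofFn, Finset.card_univ, Fintype.card_fin, Nat.sub_self, pow_zero, one_mul,
    zero_mul] at h3
  rw [h3.symm.trans (by rw [List.ofFn_eq_map])] at h2
  simpa [h2] using h1

open Classical in
/-- The permanent of an `n × n` doubly stochastic matrix is at least `e ^ (-n)`. -/
theorem one_div_exp_le_permanent {n : ℕ} (a : Fin n → Fin n → ℝ)
    (ha : ∀ j i, 0 ≤ a j i) (hrow : ∀ j, ∑ i, a j i = 1) (hcol : ∀ i, ∑ j, a j i = 1) :
    1 / Real.exp 1 ^ n ≤
      ∑ g : Fin n → Fin n, if Function.Injective g then ∏ j, a j (g j) else 0 := by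
  -- Mixing with the uniform matrix makes all entries positive; then `t` tends to `0`.
  set F : ℝ → ℝ := fun t => ∑ g : Fin n → Fin n,
    if Function.Injective g then ∏ j, ((1 - t) * a j (g j) + t / n) else 0 with hF
  have hcont : Continuous F := by
    refine continuous_finsetSum _ fun g _ => ?_
    split_ifs <;> fun_prop
  have hlim : Tendsto F (𝓝[>] 0) (𝓝 (F 0)) := (hcont.tendsto 0).mono_left nhdsWithin_le_nhds
  have hev : ∀ᶠ t in 𝓝[>] (0 : ℝ), 1 / Real.exp 1 ^ n ≤ F t := by
    filter_upwards [Ioo_mem_nhdsGT (zero_lt_one' ℝ)] with t ht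
    have hn : ∀ _ : Fin n, (n : ℝ) ≠ 0 := fun j => by
      have := j.pos
      positivity
    refine one_div_exp_le_permanent_of_pos (fun j i => (1 - t) * a j i + t / n)
      (fun j i => ?_) (fun j => ?_) (fun i => ?_)
    · have h1 := mul_nonneg (sub_nonneg.2 ht.2.le) (ha j i)
      have h2 : 0 < t / n := div_pos ht.1 (by have := j.pos; positivity)
      linarith
    · have := hn j
      rw [Finset.sum_add_distrib, ← Finset.mul_sum, hrow]
      simp
      field_simp
      ring
    · have := hn i
      rw [Finset.sum_add_distrib, ← Finset.mul_sum, hcol]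
      simp
      field_simp
      ring
  have := ge_of_tendsto hlim hev
  simpa [hF] using this

/-- A `d`-regular bipartite graph on `n + n` vertices has at least `(d / e) ^ n` perfect
matchings. -/
theorem div_exp_pow_le_card_perfectMatchings {n d : ℕ} (hd : 0 < d) (B : Fin n → Fin n → Prop)
    (hrow : ∀ j, Nat.card {i // B j i} = d) (hcol : ∀ i, Nat.card {j // B j i} = d) :
    ((d : ℝ) / Real.exp 1) ^ n ≤
      Nat.card {g : Fin n → Fin n // Function.Injective g ∧ ∀ j, B j (g j)} := by
  classical
  have hd0 : (d : ℝ) ≠ 0 := by positivity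
  simp only [Nat.card_eq_fintype_card, Fintype.card_subtype] at hrow hcol ⊢
  have h := one_div_exp_le_permanent (fun j i => if B j i then (1 / d : ℝ) else 0)
    (fun j i => by split_ifs <;> positivity)
    (fun j => by rw [← Finset.sum_filter, Finset.sum_const, hrow]; simp [hd0])
    (fun i => by rw [← Finset.sum_filter, Finset.sum_const, hcol]; simp [hd0])
  have h2 : ∀ g : Fin n → Fin n,
      (if Function.Injective g then ∏ j, (if B j (g j) then (1 / d : ℝ) else 0) else 0) =
        if Function.Injective g ∧ ∀ j, B j (g j) then (1 / d : ℝ) ^ n else 0 := by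
    intro g
    by_cases hg : Function.Injective g
    · by_cases hB : ∀ j, B j (g j)
      · simp [hg, hB]
      · rw [if_pos hg, if_neg fun h => hB h.2]
        obtain ⟨j, hj⟩ := not_forall.1 hB
        exact Finset.prod_eq_zero (Finset.mem_univ j) (if_neg hj)
    · simp [hg]
  simp only [h2] at h
  rw [← Finset.sum_filter, Finset.sum_const, nsmul_eq_mul] at h
  rw [div_pow, div_le_iff₀ (by positivity)]
  rw [div_le_iff₀ (by positivity), one_div, inv_pow] at h
  have hdn : 0 < (d : ℝ) ^ n := by positivity
  calc (d : ℝ) ^ n = d ^ n * 1 := (mul_one _).symm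
    _ ≤ d ^ n * (_ * ((d : ℝ) ^ n)⁻¹ * Real.exp 1 ^ n) := by gcongr
    _ = _ := by field_simp

end Permanent

/-! ### Counting Latin squares row by row. -/

section LatinRectangles

/-- Latin rectangles with `k` rows and `n` columns. -/
def LatinRectangle (k n : ℕ) : Type :=
  {A : Fin k → Fin n → Fin n //
    (∀ i, Function.Injective (A i)) ∧ ∀ j, Function.Injective fun i => A i j}

instance (k n : ℕ) : Finite (LatinRectangle k n) := by
  unfold LatinRectangle; infer_instance

theorem card_unused_symbols {k n : ℕ} (A : LatinRectangle k n) (j : Fin n) :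
    Nat.card {c // ∀ i, A.1 i j ≠ c} = n - k := by
  classical
  rw [Nat.card_eq_fintype_card, Fintype.card_subtype]
  have : (Finset.univ.filter fun c => ∀ i, A.1 i j ≠ c) =
      (Finset.univ.image fun i => A.1 i j)ᶜ := by
    ext c; simp
  rw [this, Finset.card_compl, Finset.card_image_of_injective _ (A.2.2 j)]
  simp

theorem card_unused_columns {k n : ℕ} (A : LatinRectangle k n) (c : Fin n) :
    Nat.card {j // ∀ i, A.1 i j ≠ c} = n - k := by
  classical
  rw [Nat.card_eq_fintype_card, Fintype.card_subtype]
  have hb : ∀ i, Function.Bijective (A.1 i) := fun i => Finite.injective_iff_bijective.1 (A.2.1 i)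
  choose p hp using fun i => (hb i).2 c
  have : (Finset.univ.filter fun j => ∀ i, A.1 i j ≠ c) = (Finset.univ.image p)ᶜ := by
    ext j
    simp only [Finset.mem_filter, Finset.mem_univ, true_and, Finset.mem_compl, Finset.mem_image,
      not_exists]
    exact forall_congr' fun i => not_congr
      ⟨fun h => (hb i).1 ((hp i).trans h.symm), fun h => h ▸ hp i⟩
  have hinj : Function.Injective p := by
    intro i i' h
    refine A.2.2 (p i) ?_
    change A.1 i (p i) = A.1 i' (p i)
    rw [hp, h, hp]
  rw [this, Finset.card_compl, Finset.card_image_of_injective _ hinj]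
  simp

/-- Adding a compatible row on top of a Latin rectangle. -/
def LatinRectangle.cons {k n : ℕ} (A : LatinRectangle k n)
    (g : {g : Fin n → Fin n // Function.Injective g ∧ ∀ j, ∀ i, A.1 i j ≠ g j}) :
    LatinRectangle (k + 1) n :=
  ⟨Fin.cons g.1 A.1, Fin.cases (by simpa using g.2.1) (fun i => by simpa using A.2.1 i), fun j => by
    have : (fun i => (Fin.cons g.1 A.1 : Fin (k + 1) → Fin n → Fin n) i j) =
        Fin.cons (g.1 j) fun i => A.1 i j := by
      funext i
      cases i using Fin.cases <;> simp
    rw [this, Fin.cons_injective_iff]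
    exact ⟨by rintro ⟨i, hi⟩; exact g.2.2 j i hi, A.2.2 j⟩⟩

/-- Join a column to the symbols it does not yet contain: the graph is `(n - k)`-regular on both
sides, and its perfect matchings are the admissible new rows. -/
theorem card_latinRectangle_succ {k n : ℕ} (hk : k < n) :
    Nat.card (LatinRectangle k n) * (((n - k : ℕ) : ℝ) / Real.exp 1) ^ n ≤
      Nat.card (LatinRectangle (k + 1) n) := by
  let T := fun A : LatinRectangle k n =>
    {g : Fin n → Fin n // Function.Injective g ∧ ∀ j, ∀ i, A.1 i j ≠ g j}
  have := Fintype.ofFinite (LatinRectangle k n)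
  have hinj : Function.Injective fun p : Σ A, T A => p.1.cons p.2 := by
    rintro ⟨A, g⟩ ⟨A', g'⟩ h
    have h1 := congrArg Subtype.val h
    simp only [LatinRectangle.cons] at h1
    obtain ⟨hg, hA⟩ := Fin.cons_inj.1 h1
    obtain rfl := Subtype.ext hA
    obtain rfl := Subtype.ext hg
    rfl
  have h1 := Nat.card_le_card_of_injective _ hinj
  rw [Nat.card_sigma] at h1
  refine le_trans ?_ (Nat.cast_le.2 h1)
  push_cast
  rw [Nat.card_eq_fintype_card, ← nsmul_eq_mul, ← Finset.card_univ]
  refine Finset.card_nsmul_le_sum _ _ _ fun A _ => ?_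
  exact div_exp_pow_le_card_perfectMatchings (by omega) (fun j c => ∀ i, A.1 i j ≠ c)
    (card_unused_symbols A) (card_unused_columns A)

theorem descFactorial_pow_le_card_latinRectangle {k n : ℕ} (hk : k ≤ n) :
    ((n.descFactorial k : ℝ) / Real.exp 1 ^ k) ^ n ≤ Nat.card (LatinRectangle k n) := by
  induction k with
  | zero =>
    have : Nonempty (LatinRectangle 0 n) :=
      ⟨⟨fun i => i.elim0, fun i => i.elim0, fun _ i => i.elim0⟩⟩
    have := Nat.card_pos (α := LatinRectangle 0 n)
    simpa [Nat.one_le_iff_ne_zero] using this.ne'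
  | succ k ih =>
    refine le_trans ?_ (card_latinRectangle_succ (by omega))
    refine le_trans (le_of_eq ?_) (mul_le_mul_of_nonneg_right (ih (by omega)) (by positivity))
    rw [← mul_pow, Nat.descFactorial_succ, pow_succ]
    push_cast
    congr 1
    field_simp

theorem factorial_pow_le_latinCount (n : ℕ) :
    (((n ! : ℕ) : ℝ) / Real.exp 1 ^ n) ^ n ≤ latinCount n := by
  have h := descFactorial_pow_le_card_latinRectangle (le_refl n)
  rw [Nat.descFactorial_self] at h
  refine h.trans (le_of_eq ?_)
  rw [latinCount, LatinRectangle]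
  simp only [IsLatinSquare, Finite.injective_iff_bijective]

theorem latinCount_le (n : ℕ) : latinCount n ≤ (n ^ n) ^ n := by
  refine (Nat.card_le_card_of_injective _ Subtype.val_injective).trans_eq ?_
  simp

end LatinRectangles

/-! ### Logarithmic estimates for the factors of $E_{n,k}$. -/

section Asymptotics

theorem log_factorial_le (n : ℕ) : Real.log (n ! : ℕ) ≤ n * Real.log n := by
  rw [← Real.log_pow]
  exact Real.log_le_log (by positivity) (by exact_mod_cast Nat.factorial_le_pow n)

theorem mul_log_sub_le_log_factorial (n : ℕ) :
    n * Real.log n - n ≤ Real.log (n ! : ℕ) := by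
  rcases n.eq_zero_or_pos with rfl | hn
  · simp
  have h := Real.pow_div_factorial_le_exp (n : ℝ) n.cast_nonneg n
  have h2 := Real.log_le_log (by positivity) h
  rw [Real.log_exp, Real.log_div (by positivity) (by positivity), Real.log_pow] at h2
  linarith

theorem log_completionBound (n k : ℕ) :
    Real.log (completionBound n k) =
      ∑ l ∈ Finset.Icc 1 (n - k), (n : ℝ) / l * Real.log (l ! : ℕ) := by
  rw [completionBound, Real.log_prod]
  · exact Finset.sum_congr rfl fun l _ => Real.log_rpow (by positivity) _
  · intro l _
    positivity

theorem sum_log_Icc (m : ℕ) : ∑ l ∈ Finset.Icc 1 m, Real.log l = Real.log (m ! : ℕ) := by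
  induction m with
  | zero => simp
  | succ m ih =>
    rw [Finset.sum_Icc_succ_top (by omega), ih, Nat.factorial_succ, Nat.cast_mul,
      Real.log_mul (by positivity) (by positivity), add_comm]

theorem log_completionBound_le (n k : ℕ) :
    Real.log (completionBound n k) ≤ n * Real.log ((n - k)! : ℕ) := by
  rw [log_completionBound, ← sum_log_Icc, Finset.mul_sum]
  refine Finset.sum_le_sum fun l hl => ?_
  have hl : 0 < (l : ℝ) := by exact_mod_cast (Finset.mem_Icc.1 hl).1
  calc (n : ℝ) / l * Real.log (l ! : ℕ) ≤ n / l * (l * Real.log l) := by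
        gcongr
        exact log_factorial_le l
    _ = _ := by field_simp

theorem le_log_completionBound (n k : ℕ) :
    n * Real.log ((n - k)! : ℕ) - n * (n - k : ℕ) ≤ Real.log (completionBound n k) := by
  rw [log_completionBound, ← sum_log_Icc]
  have h : ∑ l ∈ Finset.Icc 1 (n - k), (n : ℝ) * (Real.log l - 1) =
      n * ∑ l ∈ Finset.Icc 1 (n - k), Real.log l - n * (n - k : ℕ) := by
    rw [← Finset.mul_sum, Finset.sum_sub_distrib, mul_sub]
    simp
  rw [← h]
  refine Finset.sum_le_sum fun l hl => ?_
  have hl : 0 < (l : ℝ) := by exact_mod_cast (Finset.mem_Icc.1 hl).1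
  calc (n : ℝ) * (Real.log l - 1) = n / l * (l * Real.log l - l) := by field_simp
    _ ≤ _ := by
        gcongr
        exact mul_log_sub_le_log_factorial l

theorem factorial_div_four_le_round {n : ℕ} (hn : 3 ≤ n) :
    ((n ! : ℕ) : ℝ) / 4 ≤ (round (((n ! : ℕ) : ℝ) / Real.exp 1) : ℝ) := by
  -- Rounding loses at most $1/2\le n!/12 = n!/3-n!/4$.
  have h6 : (6 : ℝ) ≤ (n ! : ℕ) := by exact_mod_cast Nat.factorial_le hn
  have h1 := (abs_le.1 (abs_sub_round (((n ! : ℕ) : ℝ) / Real.exp 1))).2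
  have h2 : ((n ! : ℕ) : ℝ) / 3 ≤ (n ! : ℕ) / Real.exp 1 := by
    gcongr
    linarith [Real.exp_one_lt_d9]
  linarith

theorem round_le_factorial {n : ℕ} :
    (round (((n ! : ℕ) : ℝ) / Real.exp 1) : ℝ) ≤ (n ! : ℕ) := by
  have h6 : (1 : ℝ) ≤ (n ! : ℕ) := by exact_mod_cast n.factorial_pos
  have h1 := (abs_le.1 (abs_sub_round (((n ! : ℕ) : ℝ) / Real.exp 1))).1
  have h2 : ((n ! : ℕ) : ℝ) / Real.exp 1 ≤ (n ! : ℕ) / 2 := by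
    gcongr
    linarith [Real.exp_one_gt_d9]
  linarith

theorem latinCount_pos (n : ℕ) : 0 < (latinCount n : ℝ) :=
  lt_of_lt_of_le (by positivity) (factorial_pow_le_latinCount n)

theorem log_latinCount_le (n : ℕ) : Real.log (latinCount n) ≤ n * (n * Real.log n) := by
  rw [← Real.log_pow, ← Real.log_pow]
  exact Real.log_le_log (latinCount_pos n) (by exact_mod_cast latinCount_le n)

theorem le_log_latinCount (n : ℕ) :
    n * (Real.log (n ! : ℕ) - n) ≤ Real.log (latinCount n) := by
  have h := Real.log_le_log (by positivity) (factorial_pow_le_latinCount n)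
  rwa [Real.log_pow, Real.log_div (by positivity) (by positivity), Real.log_pow, Real.log_exp,
    mul_one] at h

/-- The logarithm of `E_{n,k}` up to an error of order `n ^ 2`, uniformly in `k < n`. -/
theorem abs_log_rejectionCost_sub_le {n k : ℕ} (hn : 3 ≤ n) (hk : k < n) :
    |Real.log (rejectionCost n k) - (2 * ((n : ℝ) - k) - n) * n * Real.log n| ≤
      7 * (n : ℝ) ^ 2 := by
  have hU : 0 < completionBound n k :=
    Finset.prod_pos fun l _ => Real.rpow_pos_of_pos (by positivity) _
  have hround := factorial_div_four_le_round hn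
  set ρ := (round (((n ! : ℕ) : ℝ) / Real.exp 1) : ℝ) with hρ
  have hρpos : 0 < ρ := lt_of_lt_of_le (by positivity) hround
  have hL := latinCount_pos n
  obtain ⟨m, hm, hm0⟩ : ∃ m, n - k = m + 1 ∧ k + (m + 1) = n := ⟨n - k - 1, by omega, by omega⟩
  have hmk : (n : ℝ) - k = m + 1 := by
    rw [← hm0]; push_cast; ring
  have hlog : Real.log (rejectionCost n k) = Real.log (completionBound n k) + m * Real.log ρ
      - (Real.log (latinCount n) - Real.log (n ! : ℕ)) := by
    rw [rejectionCost, ← hρ, hm, Nat.add_sub_cancel, Real.log_div (by positivity) (by positivity),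
      Real.log_mul (by positivity) (by positivity), Real.log_pow,
      Real.log_div (by positivity) (by positivity)]
  have hn0 : (3 : ℝ) ≤ n := by exact_mod_cast hn
  have hmn : (m : ℝ) + 1 ≤ n := by exact_mod_cast (by omega : m + 1 ≤ n)
  have hm1 : (0 : ℝ) ≤ m := m.cast_nonneg
  have hU1 := log_completionBound_le n k
  have hU2 := le_log_completionBound n k
  rw [hm] at hU1 hU2
  have hF1 := log_factorial_le (m + 1)
  have hF2 := mul_log_sub_le_log_factorial (m + 1)
  have hN1 := log_factorial_le n
  have hN2 := mul_log_sub_le_log_factorial n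
  have hL1 := log_latinCount_le n
  have hL2 := le_log_latinCount n
  push_cast at hU1 hU2 hF1 hF2
  have hρ1 : Real.log ρ ≤ Real.log (n ! : ℕ) := Real.log_le_log hρpos round_le_factorial
  have hρ2 : Real.log (n ! : ℕ) - 2 ≤ Real.log ρ := by
    have h1 := Real.log_le_log (by positivity) hround
    rw [Real.log_div (by positivity) (by positivity)] at h1
    have h4 : Real.log 4 ≤ 2 := by
      rw [show (4 : ℝ) = 2 ^ 2 by norm_num, Real.log_pow]
      have := Real.log_two_lt_d9
      push_cast
      linarith
    linarith
  have hlm1 : Real.log ((m : ℝ) + 1) ≤ Real.log n := Real.log_le_log (by positivity) hmn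
  -- Replacing `log (n - k)` by `log n` costs at most `n`, even for small `n - k`, by $\log x\le
  -- x-1$ at $x=n/(m+1)$. This makes the estimate uniform in `k`.
  have hlm2 : ((m : ℝ) + 1) * Real.log n - n ≤ (m + 1) * Real.log ((m : ℝ) + 1) := by
    have h1 := Real.log_le_sub_one_of_pos (x := (n : ℝ) / (m + 1)) (by positivity)
    rw [Real.log_div (by positivity) (by positivity)] at h1
    have h2 : ((m : ℝ) + 1) * (Real.log n - Real.log ((m : ℝ) + 1)) ≤
        (m + 1) * ((n : ℝ) / (m + 1) - 1) := by gcongr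
    rw [mul_sub, mul_sub, mul_div_cancel₀ _ (by positivity)] at h2
    linarith
  set l := Real.log n
  set lm := Real.log ((m : ℝ) + 1)
  set f := Real.log (n ! : ℕ)
  set fm := Real.log ((m + 1)! : ℕ)
  rw [hmk, hlog]
  have hn' : (0 : ℝ) ≤ n := by linarith
  have a1 : (n : ℝ) * fm ≤ n * ((m + 1) * l) :=
    mul_le_mul_of_nonneg_left (hF1.trans (by gcongr)) hn'
  have a2 : (n : ℝ) * ((m + 1) * l - n - (m + 1)) ≤ n * fm :=
    mul_le_mul_of_nonneg_left (by linarith) hn'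
  have a3 : (m : ℝ) * Real.log ρ ≤ m * (n * l) := by gcongr; linarith
  have a4 : (m : ℝ) * (n * l - n - 2) ≤ m * Real.log ρ := by gcongr; linarith
  have a5 : (n : ℝ) * (n * l - n - n) ≤ Real.log (latinCount n) :=
    le_trans (mul_le_mul_of_nonneg_left (by linarith) hn') hL2
  have b1 : (m : ℝ) * n ≤ n * n := by gcongr; linarith
  have b2 : (3 : ℝ) * n ≤ n * n := by gcongr
  rw [abs_le]
  constructor <;> nlinarith

theorem tendsto_log_rejectionCost {k : ℕ → ℕ} {τ : ℝ} (hk : ∀ᶠ n in atTop, k n < n)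
    (hτ : Tendsto (fun n : ℕ => ((n : ℝ) - k n) / n) atTop (𝓝 τ)) :
    Tendsto (fun n : ℕ => Real.log (rejectionCost n (k n)) / ((n : ℝ) ^ 2 * Real.log n)) atTop
      (𝓝 (2 * τ - 1)) := by
  have hlog : Tendsto (fun n : ℕ => Real.log (n : ℝ)) atTop atTop :=
    Real.tendsto_log_atTop.comp tendsto_natCast_atTop_atTop
  have h1 : Tendsto (fun n : ℕ => 2 * (((n : ℝ) - k n) / n) - 1) atTop (𝓝 (2 * τ - 1)) :=
    (hτ.const_mul 2).sub_const 1
  have h2 : Tendsto (fun n : ℕ => Real.log (rejectionCost n (k n)) / ((n : ℝ) ^ 2 * Real.log n)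
      - (2 * (((n : ℝ) - k n) / n) - 1)) atTop (𝓝 0) := by
    refine squeeze_zero_norm' ?_ (hlog.const_div_atTop 7)
    filter_upwards [hk, eventually_ge_atTop 3] with n hkn hn
    have hn0 : (0 : ℝ) < n := by positivity
    have hl : 0 < Real.log n := Real.log_pos (by exact_mod_cast (by omega : 1 < n))
    have h := abs_log_rejectionCost_sub_le hn hkn
    have heq : Real.log (rejectionCost n (k n)) / ((n : ℝ) ^ 2 * Real.log n)
        - (2 * (((n : ℝ) - k n) / n) - 1) =
        (Real.log (rejectionCost n (k n)) - (2 * ((n : ℝ) - k n) - n) * n * Real.log n) /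
          ((n : ℝ) ^ 2 * Real.log n) := by
      field_simp
    rw [heq, Real.norm_eq_abs, abs_div, abs_of_pos (by positivity : 0 < (n : ℝ) ^ 2 * Real.log n),
      div_le_div_iff₀ (by positivity) hl]
    calc _ ≤ 7 * (n : ℝ) ^ 2 * Real.log n := by gcongr
      _ = _ := by ring
  simpa using h2.add h1

theorem isEquivalent_const_mul_of_tendsto_div {u w : ℕ → ℝ} {c : ℝ} (hc : c ≠ 0)
    (hw : ∀ᶠ n in atTop, w n ≠ 0) (h : Tendsto (fun n => u n / w n) atTop (𝓝 c)) :
    u ~[atTop] fun n => c * w n := by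
  refine (isEquivalent_iff_tendsto_one (hw.mono fun n hn => mul_ne_zero hc hn)).2 ?_
  have h2 := h.div_const c
  rw [div_self hc] at h2
  refine h2.congr fun n => ?_
  rw [Pi.div_apply, div_div, mul_comm]

theorem eventually_sq_mul_log_ne_zero :
    ∀ᶠ n : ℕ in atTop, (n : ℝ) ^ 2 * Real.log n ≠ 0 := by
  filter_upwards [eventually_ge_atTop 2] with n hn
  have hl : 0 < Real.log n := Real.log_pos (by exact_mod_cast hn)
  positivity

theorem eventually_lt_and_tendsto_of_tendsto_div {k : ℕ → ℕ} {a : ℝ} (ha : a < 1)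
    (h : Tendsto (fun n : ℕ => (k n : ℝ) / n) atTop (𝓝 a)) :
    (∀ᶠ n in atTop, k n < n) ∧
      Tendsto (fun n : ℕ => ((n : ℝ) - k n) / n) atTop (𝓝 (1 - a)) := by
  constructor
  · filter_upwards [h.eventually_lt_const ha, eventually_gt_atTop 0] with n hn hn0
    rw [div_lt_one (by positivity)] at hn
    exact_mod_cast hn
  · refine (h.const_sub 1).congr' ?_
    filter_upwards [eventually_gt_atTop 0] with n hn0
    have : (n : ℝ) ≠ 0 := by positivity
    field_simp

end Asymptotics

/-! ### The three asymptotic regimes. -/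

theorem mainTheorem6 :
    (∀ k : ℕ → ℕ,
      (fun n : ℕ => (k n : ℝ)) =o[atTop] (fun n : ℕ => (n : ℝ)) →
      (fun n : ℕ => Real.log (rejectionCost n (k n))) ~[atTop]
        (fun n : ℕ => (n : ℝ) ^ 2 * Real.log n)) ∧
    (∀ t : ℝ, 0 < t → t < 1 → ∀ k : ℕ → ℕ,
      (fun n : ℕ => (k n : ℝ)) ~[atTop] (fun n : ℕ => (1 - t) * (n : ℝ)) →
      (t ≠ 1 / 2 →
        (fun n : ℕ => Real.log (rejectionCost n (k n))) ~[atTop]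
          (fun n : ℕ => (2 * t - 1) * (n : ℝ) ^ 2 * Real.log n)) ∧
      (t = 1 / 2 →
        (fun n : ℕ => Real.log (rejectionCost n (k n))) =o[atTop]
          (fun n : ℕ => (n : ℝ) ^ 2 * Real.log n))) ∧
    (∀ r α : ℝ, 0 < r → r < 1 → 0 < α → α < 1 → ∀ k : ℕ → ℕ,
      (fun n : ℕ => (n : ℝ) - (k n : ℝ)) ~[atTop] (fun n : ℕ => r * (n : ℝ) ^ α) →
      (fun n : ℕ => Real.log (rejectionCost n (k n))) ~[atTop]
        (fun n : ℕ => r * (1 + α) * (n : ℝ) ^ (1 + α) * Real.log n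
          - (n : ℝ) ^ 2 * Real.log n)) := by
  refine ⟨fun k hk => ?_, fun t ht0 ht1 k hk => ?_, fun r α hr0 _ hα0 hα1 k hk => ?_⟩
  · obtain ⟨h1, h2⟩ := eventually_lt_and_tendsto_of_tendsto_div zero_lt_one
      hk.tendsto_div_nhds_zero
    have h := isEquivalent_const_mul_of_tendsto_div (by norm_num) eventually_sq_mul_log_ne_zero
      (tendsto_log_rejectionCost h1 h2)
    norm_num at h
    exact h
  · have hk' : Tendsto (fun n : ℕ => (k n : ℝ) / n) atTop (𝓝 (1 - t)) := by
      have hne : ∀ᶠ n : ℕ in atTop, (1 - t) * (n : ℝ) ≠ 0 := by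
        filter_upwards [eventually_gt_atTop 0] with n hn
        have : (n : ℝ) ≠ 0 := by positivity
        exact mul_ne_zero (by linarith) this
      have h := ((isEquivalent_iff_tendsto_one hne).1 hk).const_mul (1 - t)
      rw [mul_one] at h
      refine h.congr' ?_
      filter_upwards [hne] with n hn
      have := left_ne_zero_of_mul hn
      have := right_ne_zero_of_mul hn
      simp only [Pi.div_apply]
      field_simp
    obtain ⟨h1, h2⟩ := eventually_lt_and_tendsto_of_tendsto_div (by linarith) hk'
    have h := tendsto_log_rejectionCost h1 h2
    rw [sub_sub_cancel] at h
    refine ⟨fun ht => ?_, fun ht => ?_⟩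
    · have h3 : 2 * t - 1 ≠ 0 := fun h0 => ht (by linarith)
      simpa only [mul_assoc] using
        isEquivalent_const_mul_of_tendsto_div h3 eventually_sq_mul_log_ne_zero h
    · rw [isLittleO_iff_tendsto' (eventually_sq_mul_log_ne_zero.mono fun n hn h0 => absurd h0 hn)]
      simpa [ht] using h
  · have hpow : Tendsto (fun n : ℕ => (n : ℝ) ^ (α - 1)) atTop (𝓝 0) := by
      have := (tendsto_rpow_neg_atTop (sub_pos.2 hα1)).comp tendsto_natCast_atTop_atTop
      simpa [Function.comp_def] using this
    have hne : ∀ᶠ n : ℕ in atTop, r * (n : ℝ) ^ α ≠ 0 := by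
      filter_upwards [eventually_gt_atTop 0] with n hn
      have : (0 : ℝ) < n := by positivity
      positivity
    have hone := (isEquivalent_iff_tendsto_one hne).1 hk
    have h1 : ∀ᶠ n in atTop, k n < n := by
      filter_upwards [hone.eventually_const_lt one_pos, eventually_gt_atTop 0] with n hn hn0
      have hp : (0 : ℝ) < n := by positivity
      have hpos : 0 < r * (n : ℝ) ^ α := by positivity
      rw [Pi.div_apply, div_pos_iff_of_pos_right hpos] at hn
      exact_mod_cast sub_pos.1 hn
    have h2 : Tendsto (fun n : ℕ => ((n : ℝ) - k n) / n) atTop (𝓝 0) := by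
      have h := hone.mul (hpow.const_mul r)
      rw [mul_zero, mul_zero] at h
      refine h.congr' ?_
      filter_upwards [eventually_gt_atTop 0] with n hn
      have hp : (0 : ℝ) < n := by positivity
      simp only [Pi.div_apply]
      rw [Real.rpow_sub_one hp.ne']
      field_simp
    have hE := isEquivalent_const_mul_of_tendsto_div (by norm_num) eventually_sq_mul_log_ne_zero
      (tendsto_log_rejectionCost h1 h2)
    -- Since `α < 1`, the $n^{1+\alpha}\log n$ term is of lower order, so the stated function is
    -- itself equivalent to $-n^2\log n$.
    refine hE.trans (IsEquivalent.symm ?_)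
    refine isEquivalent_const_mul_of_tendsto_div (by norm_num) eventually_sq_mul_log_ne_zero ?_
    have h := (hpow.const_mul (r * (1 + α))).sub_const 1
    rw [mul_zero] at h
    norm_num at h ⊢
    refine h.congr' ?_
    filter_upwards [eventually_ge_atTop 2] with n hn
    have hp : (0 : ℝ) < n := by positivity
    have hl : 0 < Real.log n := Real.log_pos (by exact_mod_cast hn)
    rw [Real.rpow_sub_one hp.ne', Real.rpow_one_add' hp.le (by linarith)]
    field_simp
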